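/- Let $\mathbb{K}$ be an algebraically closed field of characteristic $0$ (for example $\mathbb{C}$), and let $n,m\ge 0$ be integers. **Conventions.** A pencil $A+\lambda B$ of linear maps $A,B:U\to V$ between finite-dimensional spaces is, in suitable bases of $U$ and $V$, block-diagonal with blocks of the following kinds: Jordan blocks $J_k(\lambda_0)+\lambda I_k$ with eigenvalue $\lambda_0\in\mathbb{K}$; Jordan blocks $I_k+\lambda J_k(0)$ with eigenvalue $\infty$ (with $k\ge1$ and $J_k(\mu)$ the $k\times k$ matrix having $\mu$ on the diagonal, $1$ on the superdiagonal and $0$ elsewhere); horizontal Kronecker blocks, of size $(h-1)\times h$ with $h\ge 1$, having $\lambda$ in the positions $(i,i)$, $1$ in the positions $(i,i+1)$ and $0$ elsewhere; and vertical Kronecker blocks, of size $v\times(v-1)$ with $v\ge1$, which are the transposes of horizontal ones. The numbers $h$ and $v$ are called the horizontal and the vertical indices. The *algebraic type* of the pencil consists of the number of distinct eigenvalues (in $\mathbb{K}\cup\{\infty\}$) of the Jordan blocks, the number and sizes of the Jordan blocks for each eigenvalue, and the multisets of horizontal and vertical indices. For a representation $\rho:\mathfrak g\to\mathrm{gl}(V)$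 and $x\in V$ put $R_x:\mathfrak g\to V$, $R_x(\xi)=\rho(\xi)x$. The *Jordan–Kronecker (JK) invariants* of $\rho$ are the algebraic type of the pencil $R_a+\lambda R_b$ for a generic pair $(a,b)$, i.e. for all $(a,b)$ in a nonempty Zariski-open subset of $V\times V$. **Theorem.** Let $\mathrm{b}(n)$ be the Lie algebra of upper triangular $n\times n$ matrices over $\mathbb{K}$, and let $\rho$ be the direct sum of $m$ copies of its standard representation on $\mathbb{K}^n$. 1. If $m\le n$, then the JK invariants of $\rho$ are: - $\frac{(n-m)(n-m+1)}{2}$ horizontal indices, namely: for each $1\le j\le n-m$ write $m=q_jj+r_j$ with integers $q_j,r_j$, $0\le r_j<j$, and take $j-r_j$ indices equal to $q_j+1$ and $r_j$ indices equal to $q_j+2$; the horizontal indices are the union, with multiplicities, of all these; - $m$ Jordan blocks, all of size $1\times1$, with pairwise distinct eigenvalues; - $\frac{m(m-1)}{2}$ vertical indices, namely: for each $1\le j\le m-1$ write $m=q_jj+r_j$ with integers $q_j,r_j$, $0\le r_j<j$, and take $j-r_j$ indices equal to $q_j$ and $r_j$ indices equal to $q_j+1$; the vertical indices are the union, with multiplicities,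 of all these. 2. If $m>n$, then the JK invariants of $\rho$ are $nm-\frac{n(n+1)}{2}$ vertical indices (there are no horizontal indices and no Jordan blocks), namely: for each $1\le j\le n$ write $m=q_j(m-j)+r_j$ with integers $q_j,r_j$, $0\le r_j<m-j$, and take $m-j-r_j$ indices equal to $q_j$ and $r_j$ indices equal to $q_j+1$; the vertical indices are the union, with multiplicities, of all these. -/

import Mathlib

noncomputable section

attribute [local instance] LieRing.ofAssociativeRing

namespace JK

/-! ### Blocks of the Jordan–Kronecker normal form -/

/-- The blocks of the Jordan–Kronecker normal form of a pair of linear maps.  All positive sizes are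
encoded by their predecessor: `jordan μ k` is the Jordan block of size `k + 1` with the (finite)
eigenvalue `μ`, `jordanInfty k` the Jordan block of size `k + 1` with eigenvalue `∞`, `horizontal k`
the horizontal Kronecker block of size `k × (k + 1)`, and `vertical k` the vertical Kronecker block
of size `(k + 1) × k`. -/
inductive Block (K : Type*) where
  | jordan (μ : K) (k : ℕ)
  | jordanInfty (k : ℕ)
  | horizontal (k : ℕ)
  | vertical (k : ℕ)

namespace Block

variable {K : Type*}

/-- Number of rows of a block. -/
@[reducible] def rows : Block K → ℕ
  | jordan _ k => k + 1
  | jordanInfty k => k + 1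
  | horizontal k => k
  | vertical k => k + 1

/-- Number of columns of a block. -/
@[reducible] def cols : Block K → ℕ
  | jordan _ k => k + 1
  | jordanInfty k => k + 1
  | horizontal k => k + 1
  | vertical k => k

/-- The first matrix `A` of the canonical pair of a block (the pencil is `A + λ B`). -/
def matA [Field K] : (b : Block K) → Matrix (Fin b.rows) (Fin b.cols) K
  | jordan μ k => fun (i j : Fin (k + 1)) =>
      if i = j then μ else if i.val + 1 = j.val then 1 else 0
  | jordanInfty k => fun (i j : Fin (k + 1)) => if i = j then 1 else 0
  | horizontal k => fun (i : Fin k) (j : Fin (k + 1)) => if i.val + 1 = j.val then 1 else 0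
  | vertical k => fun (i : Fin (k + 1)) (j : Fin k) => if i.val = j.val + 1 then 1 else 0

/-- The second matrix `B` of the canonical pair of a block (the pencil is `A + λ B`). -/
def matB [Field K] : (b : Block K) → Matrix (Fin b.rows) (Fin b.cols) K
  | jordan _ k => fun (i j : Fin (k + 1)) => if i = j then 1 else 0
  | jordanInfty k => fun (i j : Fin (k + 1)) => if i.val + 1 = j.val then 1 else 0
  | horizontal k => fun (i : Fin k) (j : Fin (k + 1)) => if i.val = j.val then 1 else 0
  | vertical k => fun (i : Fin (k + 1)) (j : Fin k) => if i.val = j.val then 1 else 0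

/-- The horizontal index (the width) of a horizontal Kronecker block. -/
def horizontalIndex? : Block K → Option ℕ
  | horizontal k => some (k + 1)
  | _ => none

/-- The vertical index (the height) of a vertical Kronecker block. -/
def verticalIndex? : Block K → Option ℕ
  | vertical k => some (k + 1)
  | _ => none

/-- The eigenvalue, in `K ∪ {∞}`, and the size of a Jordan block. -/
def jordanData? : Block K → Option (OnePoint K × ℕ)
  | jordan μ k => some ((μ : OnePoint K), k + 1)
  | jordanInfty k => some (OnePoint.infty, k + 1)
  | _ => none

end Block

/-! ### The algebraic type of a pencil -/

/-- The discrete invariants of a pencil: the multisets of horizontal and of vertical indices and,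
for each of the distinct eigenvalues, the multiset of the sizes of the Jordan blocks with that
eigenvalue (the eigenvalues themselves are forgotten; the number of distinct eigenvalues is the
cardinality of `jordan`). -/
@[ext]
structure AlgebraicType where
  horizontal : Multiset ℕ
  jordan : Multiset (Multiset ℕ)
  vertical : Multiset ℕ

open Classical in
/-- The algebraic type of a finite collection of blocks. -/
def algebraicType {K : Type*} (s : Multiset (Block K)) : AlgebraicType where
  horizontal := s.filterMap Block.horizontalIndex?
  jordan :=
    let d : Multiset (OnePoint K × ℕ) := s.filterMap Block.jordanData?
    (d.map Prod.fst).dedup.map fun μ => (d.filter fun p => p.1 = μ).map Prod.snd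
  vertical := s.filterMap Block.verticalIndex?

section Pencil

variable {K U V : Type*} [Field K] [AddCommGroup U] [Module K U] [AddCommGroup V] [Module K V]

/-- The pair of linear maps `A`, `B` has in suitable bases of `U` and `V` the block-diagonal form
with the canonical blocks `blk i`, `i ∈ ι`. -/
def HasNormalForm {ι : Type} [Fintype ι] [DecidableEq ι] (A B : U →ₗ[K] V) (blk : ι → Block K) :
    Prop :=
  ∃ (u : Module.Basis ((i : ι) × Fin (blk i).cols) K U)
    (v : Module.Basis ((i : ι) × Fin (blk i).rows) K V),
    LinearMap.toMatrix u v A = Matrix.blockDiagonal' (fun i => (blk i).matA) ∧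
    LinearMap.toMatrix u v B = Matrix.blockDiagonal' (fun i => (blk i).matB)

/-- The pencil `A + λ B` has algebraic type `t`: it has a Jordan–Kronecker normal form whose
blocks give `t`. -/
def HasAlgebraicType (A B : U →ₗ[K] V) (t : AlgebraicType) : Prop :=
  ∃ (N : ℕ) (blk : Fin N → Block K),
    HasNormalForm A B blk ∧ algebraicType (Finset.univ.val.map blk) = t

end Pencil

/-- A property holds for a generic element of a finite-dimensional vector space `W` if it holds on a
nonempty Zariski-open subset, i.e. wherever some polynomial function on `W` (a polynomial in linear
functionals) which is not identically zero does not vanish. -/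
def Generic (K : Type*) {W : Type*} [Field K] [AddCommGroup W] [Module K W] (p : W → Prop) : Prop :=
  ∃ P : MvPolynomial (Module.Dual K W) K,
    (∃ w : W, MvPolynomial.eval (fun φ : Module.Dual K W => φ w) P ≠ 0) ∧
    ∀ w : W, MvPolynomial.eval (fun φ : Module.Dual K W => φ w) P ≠ 0 → p w

/-! ### Representations -/

section Representation

variable {K L V : Type*} [Field K] [LieRing L] [LieAlgebra K L] [AddCommGroup V] [Module K V]

/-- The operator `R_x : L → V`, `R_x ξ = ρ(ξ) x`. -/
def orbitMap (ρ : L →ₗ⁅K⁆ Module.End K V) (x : V) : L →ₗ[K] V :=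
  (ρ : L →ₗ[K] Module.End K V).flip x

/-- The Jordan–Kronecker invariant of `ρ` is `t`: the pencil `R_a + λ R_b` has algebraic type `t`
for a generic pair `(a, b)`. -/
def IsJKInvariant (ρ : L →ₗ⁅K⁆ Module.End K V) (t : AlgebraicType) : Prop :=
  Generic K fun w : V × V => HasAlgebraicType (orbitMap ρ w.1) (orbitMap ρ w.2) t

/-- The direct sum of `m` copies of a representation. -/
def sumRep (ρ : L →ₗ⁅K⁆ Module.End K V) (m : ℕ) : L →ₗ⁅K⁆ Module.End K (Fin m → V) where
  toFun ξ := LinearMap.pi fun i => (ρ ξ).comp (LinearMap.proj i)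
  map_add' ξ η := by ext; simp
  map_smul' c ξ := by ext; simp
  map_lie' := by
    intro ξ η
    refine LinearMap.ext fun x => funext fun i => ?_
    simp [LieRing.of_associative_ring_bracket]

end Representation

/-- The Lie algebra `b(n)` of upper triangular `n × n` matrices. -/
def b (K : Type*) [Field K] (n : ℕ) : LieSubalgebra K (Matrix (Fin n) (Fin n) K) where
  carrier := {M | M.IsUpperTriangular}
  add_mem' h h' := h.add h'
  zero_mem' := Matrix.blockTriangular_zero
  smul_mem' c _ h := fun i j hij => by simp [h hij]
  lie_mem' h h' := by
    rw [LieRing.of_associative_ring_bracket]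
    exact (h.mul h').sub (h'.mul h)

/-- The standard representation of `b(n)` on `K^n`, by multiplication of column vectors. -/
def standardRep (K : Type*) [Field K] (n : ℕ) : b K n →ₗ⁅K⁆ Module.End K (Fin n → K) :=
  ((lieEquivMatrix' (R := K) (n := Fin n)).symm :
    Matrix (Fin n) (Fin n) K →ₗ⁅K⁆ Module.End K (Fin n → K)).comp (b K n).incl

/-- Divide `m` by `j > 0` with remainder, `m = q * j + r` with `0 ≤ r < j`; the multiset consists of
`j - r` times the number `q + c` and `r` times the number `q + c + 1`. -/
def dividedIndices (c m j : ℕ) : Multiset ℕ :=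
  Multiset.replicate (j - m % j) (m / j + c) + Multiset.replicate (m % j) (m / j + c + 1)

end JK

end

noncomputable section

open scoped Matrix

attribute [local instance] LieRing.ofAssociativeRing

namespace JK

/-! ### Generic properties -/

section Generic

variable {K W W' : Type*} [Field K] [AddCommGroup W] [Module K W] [AddCommGroup W'] [Module K W']

/-! Row `i` of an upper triangular matrix (with `n - i` free entries, `i` counted from 0) affects
only the `i`-th coordinates of the `m` vectors. Hence `R_a + λ R_b` is a direct sum over `i` of
pencils of `m × (n - i)` matrices formed from the entries of `a` and `b` (`columnsToRows_orbitMap`).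
Each block is a surjective linear image of `(a, b)`, so it may be assumed generic, and finitely many
generic conditions hold together (`Generic.forall_finite`). This leaves the generic `m × p` pencil
for `1 ≤ p ≤ n` (`genericBlocks_isGenericType`).

If `p > m`, the generic pencil consists of `p - m` horizontal blocks whose sizes differ by at most
one. Such a pencil is rigid: the infinitesimal action of the two linear groups is onto
(`horizontal_ext_eq_zero`), and `generic_pencilEquiv` turns this into an open orbit by linear
algebra over a polynomial ring. The case `p < m` is the transpose. If `p = m`, then `B` is
invertible and `A B⁻¹` has simple spectrum (`genericBlocks_square`). At most one row has `p = m`, so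
eigenvalues from different rows never need to be compared. -/

/-- Evaluation of a polynomial in linear functionals at a vector. -/
def evalAt (w : W) : MvPolynomial (Module.Dual K W) K →+* K :=
  MvPolynomial.eval fun φ => φ w

@[simp] theorem evalAt_X (w : W) (φ : Module.Dual K W) : evalAt w (MvPolynomial.X φ) = φ w := by
  simp [evalAt]

@[simp] theorem evalAt_C (w : W) (c : K) : evalAt w (MvPolynomial.C c) = c := by
  simp [evalAt]

theorem Generic.of_evalAt {p : W → Prop} (P : MvPolynomial (Module.Dual K W) K)
    (h : ∃ w, evalAt w P ≠ 0) (hp : ∀ w, evalAt w P ≠ 0 → p w) : Generic K p :=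
  ⟨P, h, hp⟩

theorem Generic.mono {p q : W → Prop} (h : Generic K p) (hpq : ∀ w, p w → q w) : Generic K q := by
  obtain ⟨P, hP, hp⟩ := h
  exact ⟨P, hP, fun w hw => hpq w (hp w hw)⟩

theorem Generic.of_forall {p : W → Prop} (h : ∀ w, p w) : Generic K p :=
  ⟨1, ⟨0, by simp⟩, fun w _ => h w⟩

/-- The indeterminates are all functionals, not a basis, so a nonzero polynomial may vanish at every
point and `P * Q ≠ 0` is not enough. A common point is found on the line through the two witnesses,
where both polynomials restrict to nonzero polynomials in one variable. -/
theorem Generic.and [Infinite K] {p q : W → Prop} (hp : Generic K p) (hq : Generic K q) :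
    Generic K fun w => p w ∧ q w := by
  obtain ⟨P, ⟨w₁, h₁⟩, hP⟩ := hp
  obtain ⟨Q, ⟨w₂, h₂⟩, hQ⟩ := hq
  let toLine : MvPolynomial (Module.Dual K W) K →+* Polynomial K :=
    MvPolynomial.eval₂Hom Polynomial.C fun φ =>
      Polynomial.C (φ w₁) + Polynomial.C (φ (w₂ - w₁)) * Polynomial.X
  have eval_toLine (t : K) (R : MvPolynomial (Module.Dual K W) K) :
      (toLine R).eval t = MvPolynomial.eval (fun φ => φ (w₁ + t • (w₂ - w₁))) R := by
    have : (Polynomial.evalRingHom t).comp toLine =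
        MvPolynomial.eval fun φ : Module.Dual K W => φ (w₁ + t • (w₂ - w₁)) := by
      refine MvPolynomial.ringHom_ext (fun c => by simp [toLine]) fun φ => ?_
      simp only [toLine, RingHom.comp_apply, MvPolynomial.coe_eval₂Hom, MvPolynomial.eval₂_X,
        Polynomial.coe_evalRingHom, MvPolynomial.eval_X, Polynomial.eval_mul,
        Polynomial.eval_C, Polynomial.eval_X, map_add, map_smul, smul_eq_mul]
      ring
    exact congrArg (fun f => f R) this
  have hP0 : toLine P ≠ 0 := fun h => h₁ <| by
    have := eval_toLine 0 P
    rw [h] at this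
    simpa using this.symm
  have hQ0 : toLine Q ≠ 0 := fun h => h₂ <| by
    have := eval_toLine 1 Q
    rw [h] at this
    simpa using this.symm
  obtain ⟨t, ht⟩ : ∃ t, (toLine (P * Q)).eval t ≠ 0 := by
    by_contra! h
    have : toLine (P * Q) = 0 := Polynomial.funext fun t => by simpa using h t
    rw [map_mul] at this
    exact mul_ne_zero hP0 hQ0 this
  rw [eval_toLine] at ht
  refine ⟨P * Q, ⟨_, ht⟩, fun w hw => ?_⟩
  rw [map_mul] at hw
  exact ⟨hP w (left_ne_zero_of_mul hw), hQ w (right_ne_zero_of_mul hw)⟩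

theorem Generic.forall_finite [Infinite K] {ι : Type*} [Finite ι] {p : ι → W → Prop}
    (h : ∀ i, Generic K (p i)) : Generic K fun w => ∀ i, p i w := by
  classical
  cases nonempty_fintype ι
  suffices ∀ s : Finset ι, Generic K fun w => ∀ i ∈ s, p i w from
    (this Finset.univ).mono fun w hw i => hw i (Finset.mem_univ i)
  intro s
  induction s using Finset.induction_on with
  | empty => exact .of_forall fun w i hi => absurd hi (Finset.notMem_empty i)
  | insert a s _ ih =>
    refine ((h a).and ih).mono fun w hw i hi => ?_
    rcases Finset.mem_insert.1 hi with rfl | hi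
    · exact hw.1
    · exact hw.2 i hi

/-- Surjectivity serves to lift the witness of nonvanishing. -/
theorem Generic.comap {p : W' → Prop} (h : Generic K p) (f : W →ₗ[K] W')
    (hf : Function.Surjective f) : Generic K fun w => p (f w) := by
  obtain ⟨P, ⟨w', hw'⟩, hP⟩ := h
  have key (w : W) : MvPolynomial.eval (fun φ : Module.Dual K W => φ w)
      (MvPolynomial.rename (fun φ : Module.Dual K W' => φ.comp f) P) =
      MvPolynomial.eval (fun φ : Module.Dual K W' => φ (f w)) P := by
    rw [MvPolynomial.eval_rename]; rfl
  obtain ⟨w, rfl⟩ := hf w'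
  exact ⟨MvPolynomial.rename (fun φ => φ.comp f) P, ⟨w, by rwa [key]⟩,
    fun w hw => hP _ (by rwa [key] at hw)⟩

theorem Generic.comap_prod {p : W' × W' → Prop} (h : Generic K p) (f : W →ₗ[K] W')
    (hf : Function.Surjective f) : Generic K fun w : W × W => p (f w.1, f w.2) :=
  h.comap (f.prodMap f) (hf.prodMap hf)

end Generic

/-! ### The generic pair of matrices -/

section GenericMatrices

variable (K : Type*) [Field K] (R C : Type*)

/-- The matrix whose entries are the coordinates of the first matrix of a pair. -/
def genericFst :
    Matrix R C (MvPolynomial (Module.Dual K (Matrix R C K × Matrix R C K)) K) :=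
  fun r c => MvPolynomial.X ((Matrix.entryLinearMap K K r c).comp (LinearMap.fst K _ _))

/-- The matrix whose entries are the coordinates of the second matrix of a pair. -/
def genericSnd :
    Matrix R C (MvPolynomial (Module.Dual K (Matrix R C K × Matrix R C K)) K) :=
  fun r c => MvPolynomial.X ((Matrix.entryLinearMap K K r c).comp (LinearMap.snd K _ _))

variable {K R C}

@[simp] theorem genericFst_map (w : Matrix R C K × Matrix R C K) :
    (genericFst K R C).map (evalAt w) = w.1 := by
  ext; simp [genericFst]

@[simp] theorem genericSnd_map (w : Matrix R C K × Matrix R C K) :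
    (genericSnd K R C).map (evalAt w) = w.2 := by
  ext; simp [genericSnd]

end GenericMatrices

/-! ### Rigid pencils -/

section Rigid

/-- A polynomial family of linear maps, surjective at one point: a solution of the homogeneous
equation at this point extends to a polynomial family of solutions. -/
theorem exists_polynomial_solution {K W : Type*} [Field K] [AddCommGroup W] [Module K W]
    {ε φ : Type*} [Fintype ε] [Fintype φ] [DecidableEq φ]
    (T : Matrix φ ε (MvPolynomial (Module.Dual K W) K)) (w₀ : W)
    (S : Matrix ε φ K) (hS : T.map (evalAt w₀) * S = 1)
    (e : ε → K) (he : T.map (evalAt w₀) *ᵥ e = 0) :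
    ∃ z : ε → MvPolynomial (Module.Dual K W) K, T *ᵥ z = 0 ∧ ∀ i, evalAt w₀ (z i) = e i := by
  let S' := S.map (MvPolynomial.C (σ := Module.Dual K W))
  let e' : ε → MvPolynomial (Module.Dual K W) K := fun i => MvPolynomial.C (e i)
  have hS' : S'.map (evalAt w₀) = S := by ext; simp [S']
  have he' : (evalAt w₀ : _ → K) ∘ e' = e := by ext; simp [e']
  have hM : (T * S').map (evalAt w₀) = 1 := by rw [Matrix.map_mul, hS', hS]
  have hT : (evalAt w₀ : _ → K) ∘ (T *ᵥ e') = 0 := by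
    ext i
    have := RingHom.map_mulVec (evalAt w₀) T e' i
    rw [Function.comp_apply, this, he', he]
  -- Cramer's rule: with `M = T * S'`, applying `T` gives `det M • T e' - M adj(M) T e' = 0`. At
  -- `w₀` one has `M = 1` and `T e' = 0`, so the value there is `e`. The adjugate keeps the entries
  -- polynomial.
  refine ⟨(T * S').det • e' - S' *ᵥ ((T * S').adjugate *ᵥ (T *ᵥ e')), ?_, fun i => ?_⟩
  · rw [Matrix.mulVec_sub, Matrix.mulVec_smul, Matrix.mulVec_mulVec, Matrix.mulVec_mulVec,
      Matrix.mul_adjugate, Matrix.smul_mulVec, Matrix.one_mulVec, sub_self]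
  · have h1 : evalAt w₀ (T * S').det = 1 := by
      rw [RingHom.map_det, RingHom.mapMatrix_apply, hM, Matrix.det_one]
    have h2 : evalAt w₀ ((S' *ᵥ ((T * S').adjugate *ᵥ (T *ᵥ e'))) i) = 0 := by
      rw [Matrix.mulVec_mulVec, RingHom.map_mulVec, hT, Matrix.mulVec_zero, Pi.zero_apply]
    rw [Pi.sub_apply, map_sub, h2, Pi.smul_apply, smul_eq_mul, map_mul, h1]
    simp [e']

variable {R C : Type*} [Fintype R] [Fintype C] [DecidableEq R] [DecidableEq C]

/-- The matrix of the linear map `(X, Y) ↦ (Y A - A₀ X, Y B - B₀ X)`. -/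
def intertwining {k : Type*} [CommRing k] (A₀ B₀ A B : Matrix R C k) :
    Matrix ((R × C) ⊕ (R × C)) ((C × C) ⊕ (R × R)) k
  | .inl (r, c), .inl (c', c'') => if c'' = c then - A₀ r c' else 0
  | .inl (r, c), .inr (r', r'') => if r' = r then A r'' c else 0
  | .inr (r, c), .inl (c', c'') => if c'' = c then - B₀ r c' else 0
  | .inr (r, c), .inr (r', r'') => if r' = r then B r'' c else 0

theorem intertwining_mulVec {k : Type*} [CommRing k] (A₀ B₀ A B : Matrix R C k)
    (z : (C × C) ⊕ (R × R) → k) :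
    intertwining A₀ B₀ A B *ᵥ z =
      Sum.elim
        (fun rc => ((Matrix.of fun i j => z (.inr (i, j))) * A -
          A₀ * (Matrix.of fun i j => z (.inl (i, j)))) rc.1 rc.2)
        (fun rc => ((Matrix.of fun i j => z (.inr (i, j))) * B -
          B₀ * (Matrix.of fun i j => z (.inl (i, j)))) rc.1 rc.2) := by
  ext (⟨r, c⟩ | ⟨r, c⟩) <;>
  simp [Matrix.mulVec, dotProduct, intertwining, Fintype.sum_prod_type, Matrix.mul_apply,
    ite_mul, sub_eq_neg_add, mul_comm]

/-- Equivalence of pairs of matrices. -/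
def PencilEquiv {k : Type*} [CommRing k] (A B A₀ B₀ : Matrix R C k) : Prop :=
  ∃ (X : Matrix C C k) (Y : Matrix R R k), IsUnit X.det ∧ IsUnit Y.det ∧
    Y * A = A₀ * X ∧ Y * B = B₀ * X

/-- A pair without infinitesimal deformations is equivalent to the generic pair. -/
theorem generic_pencilEquiv {K : Type*} [Field K] (A₀ B₀ : Matrix R C K)
    (h : ∀ D E : Matrix R C K, ∃ (X : Matrix C C K) (Y : Matrix R R K),
      Y * A₀ - A₀ * X = D ∧ Y * B₀ - B₀ * X = E) :
    Generic K fun w : Matrix R C K × Matrix R C K => PencilEquiv w.1 w.2 A₀ B₀ := by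
  let c := MvPolynomial.C (R := K) (σ := Module.Dual K (Matrix R C K × Matrix R C K))
  let T := intertwining (A₀.map c) (B₀.map c) (genericFst K R C) (genericSnd K R C)
  have hT (w : Matrix R C K × Matrix R C K) :
      T.map (evalAt w) = intertwining A₀ B₀ w.1 w.2 := by
    ext (⟨r, s⟩ | ⟨r, s⟩) (⟨i, j⟩ | ⟨i, j⟩) <;>
    simp [T, intertwining, apply_ite (evalAt w), genericFst, genericSnd, c]
  -- The hypothesis `h` says exactly that the linear system for `(X, Y)` is onto at the base point.
  have hsurj : Function.Surjective (intertwining A₀ B₀ A₀ B₀).mulVecLin := by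
    intro y
    obtain ⟨X, Y, h₁, h₂⟩ :=
      h (Matrix.of fun i j => y (.inl (i, j))) (Matrix.of fun i j => y (.inr (i, j)))
    refine ⟨Sum.elim (fun i => X i.1 i.2) (fun i => Y i.1 i.2), ?_⟩
    rw [Matrix.mulVecLin_apply, intertwining_mulVec]
    ext (⟨i, j⟩ | ⟨i, j⟩)
    · exact congrFun (congrFun h₁ i) j
    · exact congrFun (congrFun h₂ i) j
  obtain ⟨S, hS⟩ := LinearMap.exists_rightInverse_of_surjective _ (LinearMap.range_eq_top.2 hsurj)
  have hS' : intertwining A₀ B₀ A₀ B₀ * LinearMap.toMatrix' S = 1 := by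
    have := congrArg LinearMap.toMatrix' hS
    rwa [LinearMap.toMatrix'_comp, LinearMap.toMatrix'_id, ← Matrix.toLin'_apply',
      LinearMap.toMatrix'_toLin'] at this
  -- The pair `(1, 1)` solves the system at the base point; its polynomial extension stays
  -- invertible wherever `det X * det Y ≠ 0`.
  have he : intertwining A₀ B₀ A₀ B₀ *ᵥ
      Sum.elim (fun i : C × C => (1 : Matrix C C K) i.1 i.2)
        (fun i : R × R => (1 : Matrix R R K) i.1 i.2) = 0 := by
    rw [intertwining_mulVec]
    ext (⟨i, j⟩ | ⟨i, j⟩)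
    · change ((1 : Matrix R R K) * A₀ - A₀ * (1 : Matrix C C K)) i j = 0
      simp
    · change ((1 : Matrix R R K) * B₀ - B₀ * (1 : Matrix C C K)) i j = 0
      simp
  obtain ⟨z, hz, hz₀⟩ := exists_polynomial_solution T (A₀, B₀) (LinearMap.toMatrix' S)
    (by rw [hT, hS']) _ (by rw [hT, he])
  let X := Matrix.of fun i j => z (.inl (i, j))
  let Y := Matrix.of fun i j => z (.inr (i, j))
  have hX₀ : X.map (evalAt (A₀, B₀)) = 1 := by ext i j; exact hz₀ (.inl (i, j))
  have hY₀ : Y.map (evalAt (A₀, B₀)) = 1 := by ext i j; exact hz₀ (.inr (i, j))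
  refine Generic.of_evalAt (X.det * Y.det) ⟨(A₀, B₀), ?_⟩ fun w hw => ?_
  · rw [map_mul, RingHom.map_det, RingHom.map_det, RingHom.mapMatrix_apply, RingHom.mapMatrix_apply,
      hX₀, hY₀]
    simp
  · rw [map_mul, RingHom.map_det, RingHom.map_det] at hw
    rw [intertwining_mulVec] at hz
    have h₁ : Y * genericFst K R C = A₀.map c * X := by
      ext1 i j; exact sub_eq_zero.1 (congrFun hz (.inl (i, j)))
    have h₂ : Y * genericSnd K R C = B₀.map c * X := by
      ext1 i j; exact sub_eq_zero.1 (congrFun hz (.inr (i, j)))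
    have hc (M : Matrix R C K) : (M.map c).map (evalAt w) = M := by ext; simp [c]
    refine ⟨X.map (evalAt w), Y.map (evalAt w), (left_ne_zero_of_mul hw).isUnit,
      (right_ne_zero_of_mul hw).isUnit, ?_, ?_⟩
    · simpa [Matrix.map_mul, hc] using congrArg (fun M => M.map (evalAt w)) h₁
    · simpa [Matrix.map_mul, hc] using congrArg (fun M => M.map (evalAt w)) h₂

end Rigid

/-! ### Horizontal blocks have no infinitesimal deformations -/

section HorizontalRigid

variable {K : Type*} [Field K]

/-- The solution of `x (i + 1) (c + 1) = x i c + g i c` with given boundary values. -/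
def diagonalSolution (x₀ y₀ : ℕ → K) (g : ℕ → ℕ → K) : ℕ → ℕ → K
  | 0, c => x₀ c
  | i + 1, 0 => y₀ i
  | i + 1, c + 1 => diagonalSolution x₀ y₀ g i c + g i c

theorem diagonalSolution_add (x₀ y₀ : ℕ → K) (g : ℕ → ℕ → K) (i j : ℕ) :
    diagonalSolution x₀ y₀ g i (j + i) = x₀ j + ∑ s ∈ Finset.range i, g s (j + s) := by
  induction i with
  | zero => simp [diagonalSolution]
  | succ i ih => rw [← add_assoc, diagonalSolution, ih, Finset.sum_range_succ, add_assoc]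

theorem horizontal_matA_mul {k : ℕ} {ι : Type*} (X : Matrix (Fin (k + 1)) ι K) (i : Fin k) (c : ι) :
    ((Block.horizontal (K := K) k).matA * X) i c = X i.succ c := by
  rw [Matrix.mul_apply, Finset.sum_eq_single i.succ]
  · simp [Block.matA]
  · intro j _ hj
    have : ¬ (i.val + 1 = j.val) := fun h => hj (Fin.ext (by simp [h]))
    simp [Block.matA, this]
  · simp

theorem horizontal_matB_mul {k : ℕ} {ι : Type*} (X : Matrix (Fin (k + 1)) ι K) (i : Fin k) (c : ι) :
    ((Block.horizontal (K := K) k).matB * X) i c = X i.castSucc c := by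
  rw [Matrix.mul_apply, Finset.sum_eq_single i.castSucc]
  · simp [Block.matB]
  · intro j _ hj
    have : ¬ (i.val = j.val) := fun h => hj (Fin.ext (by simp [h]))
    simp [Block.matB, this]
  · simp

theorem mul_horizontal_matA_zero {k : ℕ} {ι : Type*} (Y : Matrix ι (Fin k) K) (i : ι) :
    (Y * (Block.horizontal (K := K) k).matA) i (0 : Fin (k + 1)) = 0 := by
  rw [Matrix.mul_apply]
  exact Finset.sum_eq_zero fun j _ => by simp [Block.matA]

theorem mul_horizontal_matA_succ {k : ℕ} {ι : Type*} (Y : Matrix ι (Fin k) K) (i : ι) (c : Fin k) :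
    (Y * (Block.horizontal (K := K) k).matA) i c.succ = Y i c := by
  rw [Matrix.mul_apply, Finset.sum_eq_single c]
  · simp [Block.matA]
  · intro j _ hj
    have : ¬ (j.val = c.val) := fun h => hj (Fin.ext h)
    simp [Block.matA, this]
  · simp

theorem mul_horizontal_matB_last {k : ℕ} {ι : Type*} (Y : Matrix ι (Fin k) K) (i : ι) :
    (Y * (Block.horizontal (K := K) k).matB) i (Fin.last k) = 0 := by
  rw [Matrix.mul_apply]
  refine Finset.sum_eq_zero fun j _ => ?_
  have : ¬ (j.val = k) := j.isLt.ne
  simp [Block.matB, this]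

theorem mul_horizontal_matB_castSucc {k : ℕ} {ι : Type*} (Y : Matrix ι (Fin k) K) (i : ι)
    (c : Fin k) : (Y * (Block.horizontal (K := K) k).matB) i c.castSucc = Y i c := by
  rw [Matrix.mul_apply, Finset.sum_eq_single c]
  · simp [Block.matB]
  · intro j _ hj
    have : ¬ (j.val = c.val) := fun h => hj (Fin.ext h)
    simp [Block.matB, this]
  · simp

/-- Eliminating `Y` leaves a recursion for `X` along diagonals, with values prescribed in column 0
below row 0 and in the last column for rows `< l`. As `l ≤ k + 1`, no diagonal carries both
prescriptions: those reaching the last column in such a row start in row 0, where the value is free.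
-/
theorem horizontal_ext_eq_zero {k l : ℕ} (hkl : l ≤ k + 1) (D E : Matrix (Fin l) (Fin (k + 1)) K) :
    ∃ (X : Matrix (Fin (l + 1)) (Fin (k + 1)) K) (Y : Matrix (Fin l) (Fin k) K),
      Y * (Block.horizontal (K := K) k).matA - (Block.horizontal (K := K) l).matA * X = D ∧
      Y * (Block.horizontal (K := K) k).matB - (Block.horizontal (K := K) l).matB * X = E := by
  -- Extension by zero makes the terms of a diagonal sum vanish once it has left the matrix.
  let d (i c : ℕ) : K := if h : i < l ∧ c < k + 1 then D ⟨i, h.1⟩ ⟨c, h.2⟩ else 0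
  let e (i c : ℕ) : K := if h : i < l ∧ c < k + 1 then E ⟨i, h.1⟩ ⟨c, h.2⟩ else 0
  let g (i c : ℕ) : K := e i c - d i (c + 1)
  have hd (i : Fin l) (c : Fin (k + 1)) : d i c = D i c := dif_pos ⟨i.isLt, c.isLt⟩
  have he (i : Fin l) (c : Fin (k + 1)) : e i c = E i c := dif_pos ⟨i.isLt, c.isLt⟩
  -- The free value in row 0 is minus the full diagonal sum, so that only the term `- e i k` remains
  -- on arrival in the last column.
  let x := diagonalSolution (fun c => - ∑ s ∈ Finset.range l, g s (c + s)) (fun i => - d i 0) g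
  have hx (i : ℕ) (hi : i < l) : x i k = - e i k := by
    -- Here `l ≤ k + 1` enters: it gives `i ≤ k`, so the diagonal through `(i, k)` starts in row 0.
    obtain ⟨j, rfl⟩ : ∃ j, k = j + i := ⟨k - i, by omega⟩
    have hg : ∀ s ∈ Finset.range l, s ∉ Finset.range (i + 1) → g s (j + s) = 0 := by
      intro s _ hs
      rw [Finset.mem_range, not_lt] at hs
      have h₁ : ¬ (j + s < j + i + 1) := by omega
      have h₂ : ¬ (j + s + 1 < j + i + 1) := by omega
      simp only [g, d, e, h₁, h₂, and_false, dite_false, sub_zero]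
    have hgi : g i (j + i) = e i (j + i) := by simp [g, d]
    rw [show x i (j + i) = _ from diagonalSolution_add _ _ _ _ _,
      ← Finset.sum_subset (Finset.range_mono hi) hg, Finset.sum_range_succ, hgi]
    ring
  refine ⟨Matrix.of fun i c => x i c, Matrix.of fun i c => x i c + e i c, ?_, ?_⟩
  · ext i (c : Fin (k + 1))
    rw [Matrix.sub_apply, horizontal_matA_mul]
    cases c using Fin.cases with
    | zero =>
      rw [mul_horizontal_matA_zero, ← hd]
      simp [x, diagonalSolution]
    | succ c =>
      rw [mul_horizontal_matA_succ, ← hd]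
      simp [x, diagonalSolution, g]
  · ext i (c : Fin (k + 1))
    rw [Matrix.sub_apply, horizontal_matB_mul]
    cases c using Fin.lastCases with
    | last =>
      rw [mul_horizontal_matB_last, ← he]
      simp [hx i i.isLt]
    | cast c =>
      rw [mul_horizontal_matB_castSucc, ← he]
      simp

end HorizontalRigid

/-! ### Products with block-diagonal matrices -/

section BlockDiagonal

variable {k : Type*} [CommRing k] {ι : Type*} [Fintype ι] [DecidableEq ι] {r c : ι → Type*}
  {α : Type*}

theorem mul_blockDiagonal'_apply [∀ i, Fintype (r i)] (M : ∀ i, Matrix (r i) (c i) k)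
    (Y : Matrix α ((i : ι) × r i) k)
    (p : α) (q : (i : ι) × c i) :
    (Y * Matrix.blockDiagonal' M) p q = ∑ s, Y p ⟨q.1, s⟩ * M q.1 s q.2 := by
  obtain ⟨i, q⟩ := q
  rw [Matrix.mul_apply, Fintype.sum_sigma, Finset.sum_eq_single i]
  · simp [Matrix.blockDiagonal'_apply_eq]
  · intro j _ hj
    exact Finset.sum_eq_zero fun s _ => by rw [Matrix.blockDiagonal'_apply_ne _ _ _ hj, mul_zero]
  · simp

theorem blockDiagonal'_mul_apply [∀ i, Fintype (c i)] (M : ∀ i, Matrix (r i) (c i) k)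
    (X : Matrix ((i : ι) × c i) α k)
    (p : (i : ι) × r i) (q : α) :
    (Matrix.blockDiagonal' M * X) p q = ∑ s, M p.1 p.2 s * X ⟨p.1, s⟩ q := by
  obtain ⟨i, p⟩ := p
  rw [Matrix.mul_apply, Fintype.sum_sigma, Finset.sum_eq_single i]
  · simp [Matrix.blockDiagonal'_apply_eq]
  · intro j _ hj
    exact Finset.sum_eq_zero fun s _ => by
      rw [Matrix.blockDiagonal'_apply_ne _ _ _ hj.symm, zero_mul]
  · simp

end BlockDiagonal

/-- Almost equal horizontal blocks are the normal form of the generic pencil. -/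
theorem generic_pencilEquiv_horizontal {K : Type*} [Field K] {ι : Type*} [Fintype ι]
    [DecidableEq ι] (k : ι → ℕ) (hk : ∀ i j, k i ≤ k j + 1) :
    Generic K fun w : Matrix ((i : ι) × Fin (k i)) ((i : ι) × Fin (k i + 1)) K ×
        Matrix ((i : ι) × Fin (k i)) ((i : ι) × Fin (k i + 1)) K =>
      PencilEquiv w.1 w.2
        (Matrix.blockDiagonal' fun i => (Block.horizontal (K := K) (k i)).matA)
        (Matrix.blockDiagonal' fun i => (Block.horizontal (K := K) (k i)).matB) := by
  refine generic_pencilEquiv _ _ fun D E => ?_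
  -- The deformation equations decouple into one system for each ordered pair of blocks.
  choose X Y hA hB using fun i j => horizontal_ext_eq_zero (hk i j)
    (Matrix.of fun p q => D ⟨i, p⟩ ⟨j, q⟩) (Matrix.of fun p q => E ⟨i, p⟩ ⟨j, q⟩)
  refine ⟨Matrix.of fun p q => X p.1 q.1 p.2 q.2, Matrix.of fun p q => Y p.1 q.1 p.2 q.2, ?_, ?_⟩
  · ext ⟨i, p⟩ ⟨j, q⟩
    rw [Matrix.sub_apply, mul_blockDiagonal'_apply, blockDiagonal'_mul_apply]
    exact congrFun (congrFun (hA i j) p) q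
  · ext ⟨i, p⟩ ⟨j, q⟩
    rw [Matrix.sub_apply, mul_blockDiagonal'_apply, blockDiagonal'_mul_apply]
    exact congrFun (congrFun (hB i j) p) q

/-! ### Pencils with a given multiset of blocks -/

section NormalForm

variable {K U V U' V' : Type*} [Field K] [AddCommGroup U] [Module K U] [AddCommGroup V] [Module K V]
  [AddCommGroup U'] [Module K U'] [AddCommGroup V'] [Module K V']

theorem blockDiagonal'_mulVec_apply {ι : Type*} [Fintype ι] [DecidableEq ι] {r c : ι → Type*}
    [∀ i, Fintype (c i)] (M : ∀ i, Matrix (r i) (c i) K) (x : ((i : ι) × c i) → K)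
    (p : (i : ι) × r i) :
    (Matrix.blockDiagonal' M *ᵥ x) p = ∑ s, M p.1 p.2 s * x ⟨p.1, s⟩ := by
  have := blockDiagonal'_mul_apply M (Matrix.of fun i (_ : Unit) => x i) p ()
  simpa [Matrix.mul_apply, Matrix.mulVec, dotProduct] using this

/-- Coordinate isomorphisms replace bases, so that changes of coordinates become compositions. -/
theorem hasNormalForm_iff {ι : Type} [Fintype ι] [DecidableEq ι] {A B : U →ₗ[K] V}
    {blk : ι → Block K} :
    HasNormalForm A B blk ↔
      ∃ (eU : U ≃ₗ[K] ((i : ι) × Fin (blk i).cols → K))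
        (eV : V ≃ₗ[K] ((i : ι) × Fin (blk i).rows → K)),
        (∀ x, eV (A x) = Matrix.blockDiagonal' (fun i => (blk i).matA) *ᵥ eU x) ∧
        ∀ x, eV (B x) = Matrix.blockDiagonal' (fun i => (blk i).matB) *ᵥ eU x := by
  have key {u : Module.Basis ((i : ι) × Fin (blk i).cols) K U}
      {v : Module.Basis ((i : ι) × Fin (blk i).rows) K V} {F : U →ₗ[K] V}
      {M : Matrix ((i : ι) × Fin (blk i).rows) ((i : ι) × Fin (blk i).cols) K} :
      LinearMap.toMatrix u v F = M ↔ ∀ x, v.equivFun (F x) = M *ᵥ u.equivFun x := by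
    refine ⟨fun h x => ?_, fun h => ?_⟩
    · rw [← h]
      exact (LinearMap.toMatrix_mulVec_repr u v F x).symm
    · refine Matrix.toLin'.injective (LinearMap.ext fun y => ?_)
      obtain ⟨x, rfl⟩ := u.equivFun.surjective y
      rw [Matrix.toLin'_apply, Matrix.toLin'_apply, ← h]
      exact LinearMap.toMatrix_mulVec_repr u v F x
  constructor
  · rintro ⟨u, v, hA, hB⟩
    exact ⟨u.equivFun, v.equivFun, key.1 hA, key.1 hB⟩
  · rintro ⟨eU, eV, hA, hB⟩
    refine ⟨.ofEquivFun eU, .ofEquivFun eV, key.2 ?_, key.2 ?_⟩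
    · simpa using hA
    · simpa using hB

/-- The pair `A`, `B` has a normal form whose blocks constitute the multiset `s`. -/
def HasBlocks (A B : U →ₗ[K] V) (s : Multiset (Block K)) : Prop :=
  ∃ (N : ℕ) (blk : Fin N → Block K), HasNormalForm A B blk ∧ Finset.univ.val.map blk = s

theorem HasBlocks.hasAlgebraicType {A B : U →ₗ[K] V} {s : Multiset (Block K)}
    (h : HasBlocks A B s) : HasAlgebraicType A B (algebraicType s) := by
  obtain ⟨N, blk, h, rfl⟩ := h
  exact ⟨N, blk, h, rfl⟩

theorem HasNormalForm.congr {ι : Type} [Fintype ι] [DecidableEq ι] {A B : U →ₗ[K] V}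
    {A' B' : U' →ₗ[K] V'} {blk : ι → Block K} (h : HasNormalForm A' B' blk) (eU : U ≃ₗ[K] U')
    (eV : V ≃ₗ[K] V') (hA : ∀ x, eV (A x) = A' (eU x)) (hB : ∀ x, eV (B x) = B' (eU x)) :
    HasNormalForm A B blk := by
  obtain ⟨fU, fV, h₁, h₂⟩ := hasNormalForm_iff.1 h
  refine hasNormalForm_iff.2 ⟨eU.trans fU, eV.trans fV, fun x => ?_, fun x => ?_⟩
  · simp [hA, h₁]
  · simp [hB, h₂]

theorem HasBlocks.congr {A B : U →ₗ[K] V} {A' B' : U' →ₗ[K] V'} {s : Multiset (Block K)}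
    (h : HasBlocks A' B' s) (eU : U ≃ₗ[K] U') (eV : V ≃ₗ[K] V')
    (hA : ∀ x, eV (A x) = A' (eU x)) (hB : ∀ x, eV (B x) = B' (eU x)) : HasBlocks A B s := by
  obtain ⟨N, blk, h, rfl⟩ := h
  exact ⟨N, blk, h.congr eU eV hA hB, rfl⟩

theorem HasNormalForm.hasBlocks {ι : Type} [Fintype ι] [DecidableEq ι] {A B : U →ₗ[K] V}
    {blk : ι → Block K} (h : HasNormalForm A B blk) :
    HasBlocks A B (Finset.univ.val.map blk) := by
  obtain ⟨eU, eV, hA, hB⟩ := hasNormalForm_iff.1 h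
  let e := (Fintype.equivFin ι).symm
  refine ⟨Fintype.card ι, blk ∘ e, hasNormalForm_iff.2
    ⟨eU.trans (LinearEquiv.funCongrLeft K K
      (Equiv.sigmaCongrLeft (β := fun i => Fin (blk i).cols) e)),
    eV.trans (LinearEquiv.funCongrLeft K K
      (Equiv.sigmaCongrLeft (β := fun i => Fin (blk i).rows) e)), fun x => ?_, fun x => ?_⟩, ?_⟩
  · ext ⟨i, r⟩
    rw [LinearEquiv.trans_apply, hA, LinearEquiv.trans_apply, blockDiagonal'_mulVec_apply]
    exact blockDiagonal'_mulVec_apply _ _ _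
  · ext ⟨i, r⟩
    rw [LinearEquiv.trans_apply, hB, LinearEquiv.trans_apply, blockDiagonal'_mulVec_apply]
    exact blockDiagonal'_mulVec_apply _ _ _
  · rw [← Multiset.map_map, ← Equiv.coe_toEmbedding, ← Finset.map_val, Finset.map_univ_equiv]

theorem map_val_eq_sum {α β : Type*} (s : Finset α) (f : α → β) :
    s.val.map f = ∑ a ∈ s, {f a} := by
  rw [Finset.sum, ← Multiset.sum_map_singleton (s.val.map f), Multiset.map_map]
  rfl

/-- Functions on a nested disjoint union of blocks of coordinates. -/
def piSigmaEquiv (K : Type*) [Field K] {ι : Type*} {κ : ι → Type*} (γ : (i : ι) → κ i → Type*) :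
    ((i : ι) → ((k : κ i) × γ i k) → K) ≃ₗ[K] (((p : (i : ι) × κ i) × γ p.1 p.2) → K) where
  toFun f p := f p.1.1 ⟨p.1.2, p.2⟩
  invFun f i p := f ⟨⟨i, p.1⟩, p.2⟩
  map_add' _ _ := rfl
  map_smul' _ _ := rfl
  left_inv _ := rfl
  right_inv _ := rfl

/-- The blocks of a direct sum. -/
theorem HasBlocks.pi {ι : Type} [Fintype ι] [DecidableEq ι] {U V : ι → Type*}
    [∀ i, AddCommGroup (U i)] [∀ i, Module K (U i)] [∀ i, AddCommGroup (V i)]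
    [∀ i, Module K (V i)] {A B : ∀ i, U i →ₗ[K] V i} {s : ι → Multiset (Block K)}
    (h : ∀ i, HasBlocks (A i) (B i) (s i)) :
    HasBlocks (LinearMap.piMap A) (LinearMap.piMap B) (∑ i, s i) := by
  choose N blk h hs using h
  choose eU eV hA hB using fun i => hasNormalForm_iff.1 (h i)
  have key : HasNormalForm (LinearMap.piMap A) (LinearMap.piMap B)
      (fun p : (i : ι) × Fin (N i) => blk p.1 p.2) := by
    refine hasNormalForm_iff.2
      ⟨(LinearEquiv.piCongrRight eU).trans (piSigmaEquiv K fun i k => Fin (blk i k).cols),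
      (LinearEquiv.piCongrRight eV).trans (piSigmaEquiv K fun i k => Fin (blk i k).rows),
      fun x => ?_, fun x => ?_⟩
    · ext ⟨⟨i, k⟩, r⟩
      rw [blockDiagonal'_mulVec_apply]
      exact (congrFun (hA i (x i)) ⟨k, r⟩).trans (blockDiagonal'_mulVec_apply _ _ _)
    · ext ⟨⟨i, k⟩, r⟩
      rw [blockDiagonal'_mulVec_apply]
      exact (congrFun (hB i (x i)) ⟨k, r⟩).trans (blockDiagonal'_mulVec_apply _ _ _)
  convert key.hasBlocks using 1
  rw [map_val_eq_sum, Fintype.sum_sigma]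
  exact Finset.sum_congr rfl fun i _ => by rw [← hs, map_val_eq_sum]

end NormalForm

/-! ### Matrix pencils: equivalence, transposition and reindexing -/

section Matrices

variable {K : Type*} [Field K] {R C R' C' : Type*} [Fintype R] [Fintype C] [DecidableEq R]
  [DecidableEq C] [Fintype R'] [Fintype C'] [DecidableEq R'] [DecidableEq C']

theorem PencilEquiv.hasNormalForm {ι : Type} [Fintype ι] [DecidableEq ι] {blk : ι → Block K}
    {A B : Matrix ((i : ι) × Fin (blk i).rows) ((i : ι) × Fin (blk i).cols) K}
    (h : PencilEquiv A B (Matrix.blockDiagonal' fun i => (blk i).matA)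
      (Matrix.blockDiagonal' fun i => (blk i).matB)) :
    HasNormalForm (Matrix.toLin' A) (Matrix.toLin' B) blk := by
  obtain ⟨X, Y, hX, hY, hA, hB⟩ := h
  refine hasNormalForm_iff.2
    ⟨Matrix.toLin'OfInv (Matrix.nonsing_inv_mul X hX) (Matrix.mul_nonsing_inv X hX),
    Matrix.toLin'OfInv (Matrix.nonsing_inv_mul Y hY) (Matrix.mul_nonsing_inv Y hY),
    fun x => ?_, fun x => ?_⟩
  · change Y *ᵥ (A *ᵥ x) = _ *ᵥ (X *ᵥ x)
    rw [Matrix.mulVec_mulVec, Matrix.mulVec_mulVec, hA]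
  · change Y *ᵥ (B *ᵥ x) = _ *ᵥ (X *ᵥ x)
    rw [Matrix.mulVec_mulVec, Matrix.mulVec_mulVec, hB]

/-- From `Y M = M₀ X` follows `M X⁻¹ = Y⁻¹ M₀`; transposing exchanges the roles of the two sides. -/
theorem PencilEquiv.transpose {A B A₀ B₀ : Matrix R C K} (h : PencilEquiv A B A₀ B₀) :
    PencilEquiv Aᵀ Bᵀ A₀ᵀ B₀ᵀ := by
  obtain ⟨X, Y, hX, hY, hA, hB⟩ := h
  have key {M M₀ : Matrix R C K} (hM : Y * M = M₀ * X) :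
      (X⁻¹)ᵀ * Mᵀ = M₀ᵀ * (Y⁻¹)ᵀ := by
    rw [← Matrix.transpose_mul, ← Matrix.transpose_mul]
    congr 1
    calc M * X⁻¹ = Y⁻¹ * (Y * M) * X⁻¹ := by rw [Matrix.nonsing_inv_mul_cancel_left _ _ hY]
      _ = Y⁻¹ * M₀ := by
        rw [hM, ← Matrix.mul_assoc, Matrix.mul_nonsing_inv_cancel_right _ _ hX]
  refine ⟨(Y⁻¹)ᵀ, (X⁻¹)ᵀ, ?_, ?_, key hA, key hB⟩
  · rw [Matrix.det_transpose]; exact Matrix.isUnit_nonsing_inv_det Y hY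
  · rw [Matrix.det_transpose]; exact Matrix.isUnit_nonsing_inv_det X hX

/-- The generic pair of matrices has blocks with the property `q`. -/
def GenericBlocks (K : Type*) [Field K] (R C : Type*) [Fintype C] [DecidableEq C]
    (q : Multiset (Block K) → Prop) : Prop :=
  Generic K fun w : Matrix R C K × Matrix R C K =>
    ∃ s, q s ∧ HasBlocks (Matrix.toLin' w.1) (Matrix.toLin' w.2) s

omit [Fintype R] [DecidableEq R] [Fintype R'] [DecidableEq R'] in
theorem GenericBlocks.reindex {q : Multiset (Block K) → Prop} (h : GenericBlocks K R C q)
    (eR : R' ≃ R) (eC : C' ≃ C) : GenericBlocks K R' C' q := by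
  refine (h.comap_prod (Matrix.reindexLinearEquiv K K eR eC).toLinearMap
    (LinearEquiv.surjective _)).mono ?_
  · rintro w ⟨s, hs, h⟩
    have key (A : Matrix R' C' K) (x : C' → K) :
        LinearEquiv.funCongrLeft K K eR.symm (Matrix.toLin' A x) =
        Matrix.toLin' (A.submatrix eR.symm eC.symm) (LinearEquiv.funCongrLeft K K eC.symm x) := by
      rw [Matrix.toLin'_apply, Matrix.toLin'_apply, Matrix.submatrix_mulVec_equiv]
      ext i
      simp [LinearEquiv.funCongrLeft, LinearMap.funLeft, Function.comp_assoc]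
    exact ⟨s, hs, h.congr (LinearEquiv.funCongrLeft K K eC.symm)
      (LinearEquiv.funCongrLeft K K eR.symm) (key w.1) (key w.2)⟩

end Matrices

/-! ### The generic rectangular pencil -/

section Rectangular

variable {K : Type*} [Field K]

/-- The blocks of consecutive sizes `m / j` and `m / j + 1`, `j` in number and `m` in total size. -/
def balancedBlocks (f : ℕ → Block K) (m j : ℕ) : Multiset (Block K) :=
  Multiset.replicate (j - m % j) (f (m / j)) + Multiset.replicate (m % j) (f (m / j + 1))

/-- The sizes of `balancedBlocks`, as an indexed family. -/
def balancedSizes (m j : ℕ) : Fin (j - m % j) ⊕ Fin (m % j) → ℕ :=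
  Sum.elim (fun _ => m / j) fun _ => m / j + 1

/-- This is the condition under which the sum of horizontal blocks is rigid. -/
theorem balancedSizes_le (m j : ℕ) (i i' : Fin (j - m % j) ⊕ Fin (m % j)) :
    balancedSizes m j i ≤ balancedSizes m j i' + 1 := by
  rcases i with i | i <;> rcases i' with i' | i' <;> simp [balancedSizes]
  omega

theorem sum_balancedSizes {m j : ℕ} (hj : 0 < j) : ∑ i, balancedSizes m j i = m := by
  have h₁ := Nat.mod_lt m hj
  obtain ⟨a, ha⟩ : ∃ a, j = a + m % j := ⟨j - m % j, by omega⟩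
  have h₂ : j - m % j = a := by omega
  have h₃ := Nat.div_add_mod m j
  simp only [balancedSizes, Fintype.sum_sum_type, Sum.elim_inl, Sum.elim_inr, Finset.sum_const,
    Finset.card_univ, Fintype.card_fin, smul_eq_mul, h₂]
  calc a * (m / j) + m % j * (m / j + 1) = (a + m % j) * (m / j) + m % j := by ring
    _ = m := by rw [← ha, h₃]

omit [Field K] in
theorem map_balancedSizes (f : ℕ → Block K) (m j : ℕ) :
    Finset.univ.val.map (fun i => f (balancedSizes m j i)) = balancedBlocks f m j := by
  rw [map_val_eq_sum, Fintype.sum_sum_type]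
  simp [balancedSizes, balancedBlocks, Multiset.nsmul_singleton]

theorem genericBlocks_horizontal {R C : Type*} [Fintype R] [Fintype C] [DecidableEq C] {m j : ℕ}
    (hj : 0 < j) (hR : Fintype.card R = m) (hC : Fintype.card C = m + j) :
    GenericBlocks K R C fun s => s = balancedBlocks Block.horizontal m j := by
  have hle := Nat.mod_lt m hj
  have h := generic_pencilEquiv_horizontal (K := K) (balancedSizes m j) (balancedSizes_le m j)
  refine GenericBlocks.reindex (h.mono fun w hw => ⟨_, map_balancedSizes _ m j, ?_⟩)
    (Fintype.equivOfCardEq ?_) (Fintype.equivOfCardEq ?_)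
  · exact (PencilEquiv.hasNormalForm
      (blk := fun i => Block.horizontal (balancedSizes m j i)) hw).hasBlocks
  · simp [hR, sum_balancedSizes hj]
  · simp only [Fintype.card_sigma, Fintype.card_fin, Finset.sum_add_distrib, sum_balancedSizes hj,
      hC]
    simp
    omega

theorem vertical_matA (k : ℕ) :
    (Block.vertical (K := K) k).matA = (Block.horizontal (K := K) k).matAᵀ := by
  funext p q
  exact if_congr eq_comm rfl rfl

theorem vertical_matB (k : ℕ) :
    (Block.vertical (K := K) k).matB = (Block.horizontal (K := K) k).matBᵀ := by
  funext p q
  exact if_congr eq_comm rfl rfl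

theorem genericBlocks_vertical {R C : Type*} [Fintype R] [Fintype C] [DecidableEq C] {m j : ℕ}
    (hj : 0 < j) (hR : Fintype.card R = m + j) (hC : Fintype.card C = m) :
    GenericBlocks K R C fun s => s = balancedBlocks Block.vertical m j := by
  have hle := Nat.mod_lt m hj
  have h := generic_pencilEquiv_horizontal (K := K) (balancedSizes m j) (balancedSizes_le m j)
  have h' := h.comap_prod (Matrix.transposeLinearEquiv _ _ K K).toLinearMap
    (LinearEquiv.surjective _)
  refine GenericBlocks.reindex (h'.mono fun w hw => ⟨_, map_balancedSizes _ m j, ?_⟩)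
    (Fintype.equivOfCardEq ?_) (Fintype.equivOfCardEq ?_)
  · refine (PencilEquiv.hasNormalForm
      (blk := fun i => Block.vertical (balancedSizes m j i)) ?_).hasBlocks
    have := PencilEquiv.transpose hw
    rw [Matrix.blockDiagonal'_transpose, Matrix.blockDiagonal'_transpose] at this
    have hA := funext fun i => vertical_matA (K := K) (balancedSizes m j i)
    have hB := funext fun i => vertical_matB (K := K) (balancedSizes m j i)
    exact (congrArg₂ (PencilEquiv w.1 w.2) (congrArg Matrix.blockDiagonal' hA)
      (congrArg Matrix.blockDiagonal' hB)).mpr this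
  · simp only [Fintype.card_sigma, Fintype.card_fin, Finset.sum_add_distrib, sum_balancedSizes hj,
      hR]
    simp
    omega
  · simp [hC, sum_balancedSizes hj]

end Rectangular

/-! ### The generic square pencil -/

section Square

variable {K : Type*} [Field K]

/-- Separability gives as many distinct roots as the size of the matrix, and eigenvectors for
distinct eigenvalues are independent. -/
theorem exists_eigenbasis {n : Type*} [Fintype n] [DecidableEq n] [IsAlgClosed K]
    (M : Matrix n n K) (hM : M.charpoly.Separable) :
    ∃ (μ : n → K) (S : Matrix n n K), Function.Injective μ ∧ IsUnit S.det ∧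
      M * S = S * Matrix.diagonal μ := by
  classical
  have hcard : M.charpoly.roots.toFinset.card = Fintype.card n := by
    rw [Multiset.toFinset_card_of_nodup (Polynomial.nodup_roots hM),
      Polynomial.splits_iff_card_roots.1 (IsAlgClosed.splits _), Matrix.charpoly_natDegree_eq_dim]
  let e : n ≃ M.charpoly.roots.toFinset := Fintype.equivOfCardEq (by simp [hcard])
  have hroot (i : n) : M.charpoly.IsRoot (e i) :=
    Polynomial.isRoot_of_mem_roots (Multiset.mem_toFinset.1 (e i).2)
  have heig (i : n) : ∃ v, Module.End.HasEigenvector (Matrix.toLin' M) (e i) v := by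
    refine Module.End.HasEigenvalue.exists_hasEigenvector ?_
    rw [Module.End.hasEigenvalue_iff_isRoot_charpoly, Matrix.charpoly_toLin']
    exact hroot i
  choose v hv using heig
  have hinj : Function.Injective fun i => (e i : K) := Subtype.val_injective.comp e.injective
  have hli := Module.End.eigenvectors_linearIndependent' _ _ hinj v hv
  refine ⟨fun i => e i, (Matrix.of v)ᵀ, hinj, ?_, ?_⟩
  · rw [Matrix.det_transpose, ← Matrix.isUnit_iff_isUnit_det,
      ← Matrix.linearIndependent_rows_iff_isUnit]
    exact hli
  · ext i j
    have := congrFun (hv j).apply_eq_smul i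
    rw [Matrix.mul_diagonal]
    simpa [Matrix.mul_apply, Matrix.mulVec, dotProduct, mul_comm] using this

theorem jordan_zero_matA (μ : K) (r s : Fin 1) : (Block.jordan μ 0).matA r s = μ :=
  if_pos (Subsingleton.elim r s)

theorem jordan_zero_matB (μ : K) (r s : Fin 1) : (Block.jordan μ 0).matB r s = 1 :=
  if_pos (Subsingleton.elim r s)

theorem jordan_matA_mulVec {m : ℕ} (ν : Fin m → K) (x : ((_ : Fin m) × Fin (0 + 1)) → K)
    (p : (_ : Fin m) × Fin (0 + 1)) :
    (Matrix.blockDiagonal' (fun i => (Block.jordan (ν i) 0).matA) *ᵥ x) p = ν p.1 * x p := by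
  obtain ⟨i, r⟩ := p
  obtain rfl : r = 0 := Subsingleton.elim (α := Fin 1) r 0
  rw [blockDiagonal'_mulVec_apply]
  refine (Fin.sum_univ_one fun s : Fin 1 => (Block.jordan (ν i) 0).matA 0 s * x ⟨i, s⟩).trans ?_
  exact congrArg (· * x ⟨i, 0⟩) (jordan_zero_matA (ν i) 0 0)

theorem jordan_matB_mulVec {m : ℕ} (ν : Fin m → K) (x : ((_ : Fin m) × Fin (0 + 1)) → K)
    (p : (_ : Fin m) × Fin (0 + 1)) :
    (Matrix.blockDiagonal' (fun i => (Block.jordan (ν i) 0).matB) *ᵥ x) p = x p := by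
  obtain ⟨i, r⟩ := p
  obtain rfl : r = 0 := Subsingleton.elim (α := Fin 1) r 0
  rw [blockDiagonal'_mulVec_apply]
  refine (Fin.sum_univ_one fun s : Fin 1 => (Block.jordan (ν i) 0).matB 0 s * x ⟨i, s⟩).trans ?_
  exact (congrArg (· * x ⟨i, 0⟩) (jordan_zero_matB (ν i) 0 0)).trans (one_mul _)

theorem hasBlocks_of_separable {m : ℕ} [IsAlgClosed K] (A B : Matrix (Fin m) (Fin m) K)
    (hB : IsUnit B.det) (h : (A * B.adjugate).charpoly.Separable) :
    ∃ μ : Fin m → K, Function.Injective μ ∧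
      HasBlocks (Matrix.toLin' A) (Matrix.toLin' B)
        (Finset.univ.val.map fun i => Block.jordan (μ i) 0) := by
  obtain ⟨μ, S, hμ, hS, hMS⟩ := exists_eigenbasis _ h
  -- Since `A B⁻¹ = (det B)⁻¹ • A adj(B)`, its eigenvalues are the rescaled `μ i`. The coordinate
  -- changes `S⁻¹` on the target and `S⁻¹ * B` on the source make `B` the identity.
  let ν : Fin m → K := fun i => B.det⁻¹ * μ i
  have hX : IsUnit (S⁻¹ * B).det := by
    rw [Matrix.det_mul]
    exact (Matrix.isUnit_nonsing_inv_det S hS).mul hB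
  have hY : IsUnit (S⁻¹).det := Matrix.isUnit_nonsing_inv_det S hS
  have hA : S⁻¹ * A = Matrix.diagonal ν * (S⁻¹ * B) := by
    have h₁ : A * B.adjugate = S * Matrix.diagonal μ * S⁻¹ := by
      rw [← hMS, Matrix.mul_nonsing_inv_cancel_right _ _ hS]
    have h₂ : B.det • A = A * B.adjugate * B := by
      rw [Matrix.mul_assoc, Matrix.adjugate_mul, Matrix.mul_smul, Matrix.mul_one]
    have h₃ : Matrix.diagonal ν = B.det⁻¹ • Matrix.diagonal μ := by
      rw [← Matrix.diagonal_smul]; rfl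
    calc S⁻¹ * A = B.det⁻¹ • (S⁻¹ * (B.det • A)) := by
          rw [Matrix.mul_smul, smul_smul, inv_mul_cancel₀ hB.ne_zero, one_smul]
      _ = B.det⁻¹ • (S⁻¹ * (S * (Matrix.diagonal μ * (S⁻¹ * B)))) := by
          rw [h₂, h₁]; simp only [Matrix.mul_assoc]
      _ = _ := by rw [Matrix.nonsing_inv_mul_cancel_left _ _ hS, h₃, Matrix.smul_mul]
  let e : ((_ : Fin m) × Fin (0 + 1)) ≃ Fin m :=
    ⟨fun p => p.1, fun i => ⟨i, 0⟩,
      fun p => Sigma.ext rfl (heq_of_eq (Subsingleton.elim (α := Fin 1) _ _)),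
      fun _ => rfl⟩
  refine ⟨ν, fun i j hij => hμ (mul_left_cancel₀ (inv_ne_zero hB.ne_zero) hij),
    HasNormalForm.hasBlocks (hasNormalForm_iff.2
      ⟨(Matrix.toLin'OfInv (Matrix.nonsing_inv_mul _ hX) (Matrix.mul_nonsing_inv _ hX)).trans
        (LinearEquiv.funCongrLeft K K e),
      (Matrix.toLin'OfInv (Matrix.nonsing_inv_mul _ hY) (Matrix.mul_nonsing_inv _ hY)).trans
        (LinearEquiv.funCongrLeft K K e), fun x => ?_, fun x => ?_⟩)⟩
  · funext p
    rw [jordan_matA_mulVec]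
    have key : S⁻¹ *ᵥ (A *ᵥ x) = Matrix.diagonal ν *ᵥ ((S⁻¹ * B) *ᵥ x) := by
      rw [Matrix.mulVec_mulVec, hA, ← Matrix.mulVec_mulVec]
    exact (congrFun key p.1).trans (Matrix.mulVec_diagonal _ _ _)
  · funext p
    rw [jordan_matB_mulVec]
    exact congrFun (Matrix.mulVec_mulVec x S⁻¹ B) p.1

/-- The open condition is `det B ≠ 0` together with the nonvanishing of the discriminant of `A
adj(B)`; the adjugate makes it polynomial in `(A, B)`. -/
theorem genericBlocks_square [IsAlgClosed K] [CharZero K] (m : ℕ) :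
    GenericBlocks K (Fin m) (Fin m) fun s =>
      ∃ μ : Fin m → K, Function.Injective μ ∧
        s = Finset.univ.val.map fun i => Block.jordan (μ i) 0 := by
  let N := genericFst K (Fin m) (Fin m) * (genericSnd K (Fin m) (Fin m)).adjugate
  -- The formal degrees are fixed so that the resultant commutes with evaluation at a point; in
  -- characteristic 0 they are the true degrees after evaluation.
  let D := Polynomial.resultant N.charpoly N.charpoly.derivative m (m - 1)
  have hN (w : Matrix (Fin m) (Fin m) K × Matrix (Fin m) (Fin m) K) :
      N.map (evalAt w) = w.1 * w.2.adjugate := by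
    rw [Matrix.map_mul, genericFst_map, ← RingHom.mapMatrix_apply, RingHom.map_adjugate,
      RingHom.mapMatrix_apply, genericSnd_map]
  have hD (w : Matrix (Fin m) (Fin m) K × Matrix (Fin m) (Fin m) K) :
      evalAt w D ≠ 0 ↔ (w.1 * w.2.adjugate).charpoly.Separable := by
    have h₁ := Matrix.charpoly_natDegree_eq_dim (w.1 * w.2.adjugate)
    have h₂ : (w.1 * w.2.adjugate).charpoly.derivative.natDegree = m - 1 := by
      rw [Polynomial.natDegree_derivative, h₁, Fintype.card_fin]
    rw [Fintype.card_fin] at h₁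
    have h₃ : Polynomial.resultant (w.1 * w.2.adjugate).charpoly
        (w.1 * w.2.adjugate).charpoly.derivative =
        Polynomial.resultant (w.1 * w.2.adjugate).charpoly
        (w.1 * w.2.adjugate).charpoly.derivative m (m - 1) := congrArg₂ _ h₁ h₂
    rw [← Polynomial.resultant_map_map, ← Polynomial.derivative_map, ← Matrix.charpoly_map, hN]
    rw [← h₃, Ne, Polynomial.resultant_eq_zero_iff, Polynomial.separable_def, not_and, not_not]
    exact imp_iff_right (Or.inl (Matrix.charpoly_monic _).ne_zero)
  refine Generic.of_evalAt ((genericSnd K (Fin m) (Fin m)).det * D)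
    -- Witness: `B = 1` and `A` with eigenvalues `0, …, m - 1`, distinct in characteristic 0.
    ⟨(Matrix.diagonal fun i => (i.val : K), 1), ?_⟩ fun w hw => ?_
  · rw [map_mul, RingHom.map_det, RingHom.mapMatrix_apply, genericSnd_map, Matrix.det_one, one_mul,
      hD, Matrix.adjugate_one, Matrix.mul_one, Matrix.charpoly_diagonal,
      Polynomial.separable_prod_X_sub_C_iff]
    exact Nat.cast_injective.comp Fin.val_injective
  · rw [map_mul, RingHom.map_det, RingHom.mapMatrix_apply, genericSnd_map] at hw
    obtain ⟨μ, hμ, h⟩ := hasBlocks_of_separable w.1 w.2 (left_ne_zero_of_mul hw).isUnit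
      ((hD w).1 (right_ne_zero_of_mul hw))
    exact ⟨_, ⟨μ, hμ, rfl⟩, h⟩

end Square

/-! ### Indices of balanced families of blocks -/

section Indices

theorem filterMap_replicate_some {α β : Type*} {f : α → Option β} {a : α} {b : β}
    (h : f a = some b) (n : ℕ) :
    (Multiset.replicate n a).filterMap f = Multiset.replicate n b := by
  induction n with
  | zero => rfl
  | succ n ih =>
    rw [Multiset.replicate_succ, Multiset.filterMap_cons_some _ _ _ h, ih, Multiset.replicate_succ]

theorem filterMap_eq_zero {α β : Type*} {f : α → Option β} {s : Multiset α}
    (h : ∀ a ∈ s, f a = none) : s.filterMap f = 0 := by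
  refine Multiset.eq_zero_of_forall_notMem fun b hb => ?_
  obtain ⟨a, ha, hab⟩ := (Multiset.mem_filterMap f s).1 hb
  rw [h a ha] at hab
  cases hab

theorem filterMap_sum {α β ι : Type*} (f : α → Option β) (t : Finset ι) (s : ι → Multiset α) :
    (∑ i ∈ t, s i).filterMap f = ∑ i ∈ t, (s i).filterMap f :=
  map_sum (⟨⟨Multiset.filterMap f, Multiset.filterMap_zero f⟩, Multiset.filterMap_add f⟩ :
    Multiset α →+ Multiset β) s t

variable {K : Type*}

theorem exists_of_mem_balancedBlocks {f : ℕ → Block K} {m j : ℕ} {a : Block K}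
    (ha : a ∈ balancedBlocks f m j) : ∃ k, a = f k := by
  rcases Multiset.mem_add.1 ha with h | h
  · exact ⟨_, Multiset.eq_of_mem_replicate h⟩
  · exact ⟨_, Multiset.eq_of_mem_replicate h⟩

theorem filterMap_balancedBlocks {f : ℕ → Block K} {g : Block K → Option ℕ}
    (h : ∀ k, g (f k) = some (k + 1)) (m j : ℕ) :
    (balancedBlocks f m j).filterMap g = dividedIndices 1 m j := by
  rw [balancedBlocks, Multiset.filterMap_add, filterMap_replicate_some (h _),
    filterMap_replicate_some (h _)]
  rfl

theorem filterMap_balancedBlocks_eq_zero {β : Type*} {f : ℕ → Block K} {g : Block K → Option β}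
    (h : ∀ k, g (f k) = none) (m j : ℕ) : (balancedBlocks f m j).filterMap g = 0 :=
  filterMap_eq_zero fun a ha => by
    obtain ⟨k, rfl⟩ := exists_of_mem_balancedBlocks ha
    exact h k

/-- Adding the divisor raises the quotient by one and keeps the remainder. Vertical blocks have
total width `p` but total height `m = p + (m - p)`, so their heights come from dividing `m`, without
the shift. -/
theorem dividedIndices_one (m : ℕ) {j : ℕ} (hj : 0 < j) :
    dividedIndices 1 m j = dividedIndices 0 (m + j) j := by
  simp [dividedIndices, Nat.add_div_right m hj]

theorem card_dividedIndices (c m : ℕ) {j : ℕ} (hj : 0 < j) : (dividedIndices c m j).card = j := by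
  have := Nat.mod_lt m hj
  simp [dividedIndices]
  omega

/-- The blocks `s` are, up to the eigenvalues, those of the generic `m × p` pencil. -/
def IsGenericType (m p : ℕ) (s : Multiset (Block K)) : Prop :=
  s.filterMap Block.horizontalIndex? = (if m < p then dividedIndices 1 m (p - m) else 0) ∧
  s.filterMap Block.verticalIndex? = (if p < m then dividedIndices 0 m (m - p) else 0) ∧
  ∃ E : Multiset (OnePoint K), E.Nodup ∧ s.filterMap Block.jordanData? = E.map (fun μ => (μ, 1)) ∧
    E.card = if p = m then m else 0

theorem genericBlocks_isGenericType [Field K] [IsAlgClosed K] [CharZero K] (m p : ℕ) {C : Type*}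
    [Fintype C] [DecidableEq C] (hC : Fintype.card C = p) :
    GenericBlocks K (Fin m) C (IsGenericType m p) := by
  rcases lt_trichotomy m p with h | rfl | h
  · refine (genericBlocks_horizontal (R := Fin m) (C := C) (m := m) (j := p - m) (by omega)
      (by simp) (by omega)).mono ?_
    rintro w ⟨_, rfl, hs⟩
    refine ⟨_, ⟨?_, ?_, 0, Multiset.nodup_zero, ?_, ?_⟩, hs⟩
    · rw [if_pos h, filterMap_balancedBlocks fun _ => rfl]
    · rw [if_neg (by omega), filterMap_balancedBlocks_eq_zero fun _ => rfl]
    · rw [filterMap_balancedBlocks_eq_zero fun _ => rfl, Multiset.map_zero]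
    · rw [if_neg (by omega), Multiset.card_zero]
  · refine ((genericBlocks_square (K := K) m).reindex (Equiv.refl (Fin m))
      (Fintype.equivFinOfCardEq hC)).mono ?_
    rintro w ⟨_, ⟨μ, hμ, rfl⟩, hs⟩
    refine ⟨_, ⟨?_, ?_, Finset.univ.val.map fun i => (μ i : OnePoint K), ?_, ?_, ?_⟩, hs⟩
    · rw [if_neg (lt_irrefl _)]
      exact filterMap_eq_zero fun a ha => by
        obtain ⟨i, _, rfl⟩ := Multiset.mem_map.1 ha
        rfl
    · rw [if_neg (lt_irrefl _)]
      exact filterMap_eq_zero fun a ha => by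
        obtain ⟨i, _, rfl⟩ := Multiset.mem_map.1 ha
        rfl
    · exact Finset.univ.nodup.map (OnePoint.coe_injective.comp hμ)
    · rw [Multiset.filterMap_map, Multiset.map_map, ← Multiset.filterMap_eq_map]
      rfl
    · simp
  · refine (genericBlocks_vertical (R := Fin m) (C := C) (m := p) (j := m - p) (by omega)
      (by simp; omega) hC).mono ?_
    rintro w ⟨_, rfl, hs⟩
    refine ⟨_, ⟨?_, ?_, 0, Multiset.nodup_zero, ?_, ?_⟩, hs⟩
    · rw [if_neg (by omega), filterMap_balancedBlocks_eq_zero fun _ => rfl]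
    · rw [if_pos h, filterMap_balancedBlocks fun _ => rfl, dividedIndices_one p (by omega),
        Nat.add_sub_of_le h.le]
    · rw [filterMap_balancedBlocks_eq_zero fun _ => rfl, Multiset.map_zero]
    · rw [if_neg (by omega), Multiset.card_zero]

/-- Each eigenvalue occurs in a single block, so every class of sizes is the singleton `{1}`. -/
theorem algebraicType_jordan_of_nodup {s : Multiset (Block K)} {E : Multiset (OnePoint K)}
    (hE : E.Nodup) (h : s.filterMap Block.jordanData? = E.map fun μ => (μ, 1)) :
    (algebraicType s).jordan = Multiset.replicate E.card {1} := by
  classical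
  simp only [algebraicType, h, Multiset.map_map, Function.comp_def, Multiset.map_id']
  rw [show E.dedup = E from hE.dedup, ← Multiset.map_const']
  refine Multiset.map_congr rfl fun μ hμ => ?_
  rw [Multiset.filter_map, Multiset.map_map]
  simp only [Function.comp_def]
  have : E.filter (· = μ) = Multiset.replicate (E.count μ) μ := by
    convert Multiset.filter_eq' E μ
  rw [Multiset.count_eq_one_of_mem hE hμ] at this
  rw [← Multiset.map_singleton (fun _ : OnePoint K => 1) μ]
  convert congrArg (Multiset.map fun _ => 1) this
  exact (Multiset.replicate_one μ).symm

theorem algebraicType_sum {n m : ℕ} {s : Fin n → Multiset (Block K)}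
    (hs : ∀ i, IsGenericType m (n - i.val) (s i)) :
    algebraicType (∑ i, s i) =
      { horizontal := ∑ i : Fin n, if m < n - i.val then dividedIndices 1 m (n - i.val - m) else 0
        jordan := Multiset.replicate (if m ≤ n then m else 0) {1}
        vertical :=
          ∑ i : Fin n, if n - i.val < m then dividedIndices 0 m (m - (n - i.val)) else 0 } := by
  choose hh hv E hE hd hc using hs
  have hsum : (∑ i, s i).filterMap Block.jordanData? = (∑ i, E i).map fun μ => (μ, 1) := by
    rw [filterMap_sum, ← Multiset.coe_mapAddMonoidHom, map_sum]
    exact Finset.sum_congr rfl fun i _ => hd i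
  have hzero (i : Fin n) (hi : n - i.val ≠ m) : E i = 0 := by
    rw [← Multiset.card_eq_zero, hc, if_neg hi]
  have hEsum : (∑ i, E i).Nodup ∧ (∑ i, E i).card = if m ≤ n then m else 0 := by
    -- Only the summand with `n - i = m` carries eigenvalues. If there is none, then `m > n` or `m =
    -- 0`, and the count is zero either way.
    by_cases h : ∃ i : Fin n, n - i.val = m
    · obtain ⟨i, hi⟩ := h
      rw [Finset.sum_eq_single i (fun j _ hj => hzero j fun h => hj (Fin.ext (by omega)))
        (fun h => absurd (Finset.mem_univ i) h), hc, if_pos hi, if_pos (by omega)]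
      exact ⟨hE i, rfl⟩
    · push Not at h
      rw [Finset.sum_eq_zero fun i _ => hzero i (h i)]
      refine ⟨Multiset.nodup_zero, ?_⟩
      split_ifs with hmn
      · rcases Nat.eq_zero_or_pos m with rfl | hm
        · rfl
        · exact absurd (by simp; omega) (h ⟨n - m, by omega⟩)
      · rfl
  ext1
  · simp only [algebraicType, filterMap_sum, hh]
  · rw [algebraicType_jordan_of_nodup hEsum.1 hsum, hEsum.2]
  · simp only [algebraicType, filterMap_sum, hv]

end Indices

/-! ### The representation of `b(n)` -/

section UpperTriangular

variable (K : Type*) [Field K]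

/-- Upper triangular matrices as families of rows. -/
def upperTriangularRows (n : ℕ) : b K n ≃ₗ[K] ((i : Fin n) → {k : Fin n // i ≤ k} → K) where
  toFun ξ i k := ξ.1 i k
  invFun f := ⟨fun i k => if h : i ≤ k then f i ⟨k, h⟩ else 0, fun _ _ h => dif_neg (not_le_of_gt h)⟩
  map_add' _ _ := rfl
  map_smul' _ _ := rfl
  left_inv ξ := by
    ext i k
    by_cases h : i ≤ k
    · exact dif_pos h
    · exact (dif_neg h).trans (ξ.2 (not_le.1 h)).symm
  right_inv f := by
    ext i k
    exact dif_pos k.2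

/-- The rows of a family of column vectors. -/
def columnsToRows (n m : ℕ) : (Fin m → Fin n → K) ≃ₗ[K] (Fin n → Fin m → K) where
  toFun a i c := a c i
  invFun a c i := a i c
  map_add' _ _ := rfl
  map_smul' _ _ := rfl
  left_inv _ := rfl
  right_inv _ := rfl

/-- The coordinates of a family of column vectors from the `i`-th one on. -/
def lowerCoordinates (n m : ℕ) (i : Fin n) :
    (Fin m → Fin n → K) →ₗ[K] Matrix (Fin m) {k : Fin n // i ≤ k} K where
  toFun a := Matrix.of fun c k => a c k
  map_add' _ _ := rfl
  map_smul' _ _ := rfl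

theorem lowerCoordinates_surjective (n m : ℕ) (i : Fin n) :
    Function.Surjective (lowerCoordinates K n m i) := fun A =>
  ⟨fun c k => if h : i ≤ k then A c ⟨k, h⟩ else 0, by ext c k; exact dif_pos k.2⟩

/-- The terms of `(ξ a_c)_i` with `k < i` vanish, leaving row `i` of `ξ` paired with the coordinates
of `a_c` from `i` on. -/
theorem columnsToRows_orbitMap (n m : ℕ) (a : Fin m → Fin n → K) (ξ : b K n) :
    columnsToRows K n m (orbitMap (sumRep (standardRep K n) m) a ξ) =
      LinearMap.piMap (fun i => Matrix.toLin' (lowerCoordinates K n m i a))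
        (upperTriangularRows K n ξ) := by
  ext i c
  change (ξ.1 *ᵥ a c) i = ∑ k : {k : Fin n // i ≤ k}, a c k * ξ.1 i k
  rw [← Finset.sum_subtype (Finset.Ici i) (fun _ => Finset.mem_Ici) fun k => a c k * ξ.1 i k]
  refine ((Finset.sum_subset (Finset.subset_univ _) fun k _ hk => ?_).trans
    (Finset.sum_congr rfl fun k _ => mul_comm (a c k) (ξ.1 i k))).symm
  rw [ξ.2 (not_le.1 fun h => hk (Finset.mem_Ici.2 h)), mul_zero]

/-- The matrices for different `i` share entries, but no independence is needed: each condition is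
pulled back separately along a surjection and the conditions are then intersected. -/
theorem isJKInvariant_sumRep [IsAlgClosed K] [CharZero K] (n m : ℕ) :
    IsJKInvariant (sumRep (standardRep K n) m)
      { horizontal := ∑ i : Fin n, if m < n - i.val then dividedIndices 1 m (n - i.val - m) else 0
        jordan := Multiset.replicate (if m ≤ n then m else 0) {1}
        vertical :=
          ∑ i : Fin n, if n - i.val < m then dividedIndices 0 m (m - (n - i.val)) else 0 } := by
  have h (i : Fin n) := (genericBlocks_isGenericType (K := K) m (n - i.val)
    (C := {k : Fin n // i ≤ k})
      ((Fintype.card_of_subtype (Finset.Ici i) fun _ => Finset.mem_Ici).trans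
        (Fin.card_Ici i))).comap_prod
      (lowerCoordinates K n m i) (lowerCoordinates_surjective K n m i)
  refine (Generic.forall_finite h).mono fun w hw => ?_
  choose s hs hblocks using hw
  rw [← algebraicType_sum hs]
  exact ((HasBlocks.pi hblocks).congr (upperTriangularRows K n) (columnsToRows K n m)
    (columnsToRows_orbitMap K n m w.1) (columnsToRows_orbitMap K n m w.2)).hasAlgebraicType

end UpperTriangular

/-! ### Reindexing the sums over rows and counting the indices -/

section Sums

theorem sum_fin_sub {M : Type*} [AddCommMonoid M] (n : ℕ) (F : ℕ → M) :
    ∑ i : Fin n, F (n - i.val) = ∑ p ∈ Finset.Icc 1 n, F p := by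
  rw [← Finset.sum_range fun i => F (n - i)]
  refine Finset.sum_nbij' (n - ·) (n - ·) ?_ ?_ ?_ ?_ ?_ <;> intro i hi <;> simp at hi ⊢ <;> omega

theorem sum_Icc_ite_lt_sub {M : Type*} [AddCommMonoid M] (n m : ℕ) (G : ℕ → M) :
    (∑ p ∈ Finset.Icc 1 n, if m < p then G (p - m) else 0) = ∑ j ∈ Finset.Icc 1 (n - m), G j := by
  rw [← Finset.sum_filter]
  refine Finset.sum_nbij' (· - m) (· + m) ?_ ?_ ?_ ?_ ?_ <;> intro i hi <;> simp at hi ⊢ <;> omega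

theorem sum_Icc_ite_sub_lt {M : Type*} [AddCommMonoid M] {n m : ℕ} (h : m ≤ n) (G : ℕ → M) :
    (∑ p ∈ Finset.Icc 1 n, if p < m then G (m - p) else 0) = ∑ j ∈ Finset.Icc 1 (m - 1), G j := by
  rw [← Finset.sum_filter]
  refine Finset.sum_nbij' (m - ·) (m - ·) ?_ ?_ ?_ ?_ ?_ <;> intro i hi <;> simp at hi ⊢ <;> omega

theorem sum_Icc_one_id (n : ℕ) : ∑ j ∈ Finset.Icc 1 n, j = n * (n + 1) / 2 := by
  have := Finset.sum_range_id_mul_two (n + 1)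
  rw [Finset.range_eq_Ico, Finset.sum_eq_sum_Ico_succ_bot n.succ_pos, Nat.add_sub_cancel,
    mul_comm (n + 1)] at this
  change (0 + ∑ j ∈ Finset.Icc 1 n, j) * 2 = _ at this
  omega

theorem card_sum_dividedIndices (c m n : ℕ) :
    (∑ j ∈ Finset.Icc 1 n, dividedIndices c m j).card = n * (n + 1) / 2 := by
  rw [Multiset.card_sum, ← sum_Icc_one_id]
  exact Finset.sum_congr rfl fun j hj => card_dividedIndices c m (Finset.mem_Icc.1 hj).1

theorem card_sum_dividedIndices_sub (c : ℕ) {m n : ℕ} (h : n < m) :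
    (∑ j ∈ Finset.Icc 1 n, dividedIndices c m (m - j)).card = n * m - n * (n + 1) / 2 := by
  rw [Multiset.card_sum, ← sum_Icc_one_id]
  have : ∑ j ∈ Finset.Icc 1 n, (dividedIndices c m (m - j)).card + ∑ j ∈ Finset.Icc 1 n, j =
      n * m := by
    rw [← Finset.sum_add_distrib, Finset.sum_congr rfl fun j hj => ?_, Finset.sum_const,
      Nat.card_Icc, Nat.add_sub_cancel, smul_eq_mul]
    have := Finset.mem_Icc.1 hj
    rw [card_dividedIndices c m (by omega)]
    omega
  omega

end Sums

end JK

end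

theorem theoremT (K : Type*) [Field K] [IsAlgClosed K] [CharZero K] (n m : ℕ) :
    (m ≤ n → ∃ t : JK.AlgebraicType,
      JK.IsJKInvariant (JK.sumRep (JK.standardRep K n) m) t ∧
      t.horizontal.card = (n - m) * (n - m + 1) / 2 ∧
      t.horizontal = ∑ j ∈ Finset.Icc 1 (n - m), JK.dividedIndices 1 m j ∧
      t.jordan = Multiset.replicate m {1} ∧
      t.vertical.card = m * (m - 1) / 2 ∧
      t.vertical = ∑ j ∈ Finset.Icc 1 (m - 1), JK.dividedIndices 0 m j) ∧
    (n < m → ∃ t : JK.AlgebraicType,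
      JK.IsJKInvariant (JK.sumRep (JK.standardRep K n) m) t ∧
      t.horizontal = 0 ∧
      t.jordan = 0 ∧
      t.vertical.card = n * m - n * (n + 1) / 2 ∧
      t.vertical = ∑ j ∈ Finset.Icc 1 n, JK.dividedIndices 0 m (m - j)) := by
  have h := JK.isJKInvariant_sumRep K n m
  -- The summation variable becomes the width `p = n - i`. In the first case `j` is the defect `p -
  -- m` or `m - p`; in the second it is `p` itself.
  rw [JK.sum_fin_sub n fun p => if m < p then JK.dividedIndices 1 m (p - m) else 0,
    JK.sum_fin_sub n fun p => if p < m then JK.dividedIndices 0 m (m - p) else 0] at h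
  refine ⟨fun hmn => ?_, fun hnm => ?_⟩
  · rw [JK.sum_Icc_ite_lt_sub n m, JK.sum_Icc_ite_sub_lt hmn, if_pos hmn] at h
    refine ⟨_, h, JK.card_sum_dividedIndices _ _ _, rfl, rfl, ?_, rfl⟩
    rw [JK.card_sum_dividedIndices]
    rcases m with _ | m
    · rfl
    · rw [Nat.add_sub_cancel, mul_comm]
  · have hh : (∑ p ∈ Finset.Icc 1 n, if m < p then JK.dividedIndices 1 m (p - m) else 0) = 0 :=
      Finset.sum_eq_zero fun p hp => if_neg (by have := Finset.mem_Icc.1 hp; omega)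
    have hv : (∑ p ∈ Finset.Icc 1 n, if p < m then JK.dividedIndices 0 m (m - p) else 0) =
        ∑ p ∈ Finset.Icc 1 n, JK.dividedIndices 0 m (m - p) :=
      Finset.sum_congr rfl fun p hp => if_pos (by have := Finset.mem_Icc.1 hp; omega)
    rw [hh, hv, if_neg (by omega)] at h
    exact ⟨_, h, rfl, rfl, JK.card_sum_dividedIndices_sub 0 hnm, rfl⟩
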